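/- Let $(\mathcal M,\wedge,S)$ be a monoidal model category: a model category with functorial factorizations and a (not necessarily symmetric) closed monoidal structure (both $A\wedge -$ and $-\wedge A$ have right adjoints for every object $A$) such that - for cofibrations $f\colon X\to Y$ and $g\colon U\to V$ the pushout-product $f\Box g\colon X\wedge V\cup_{X\wedge U}Y\wedge U\to Y\wedge V$ is a cofibration, which is trivial if $f$ or $g$ is; - for a cofibrant replacement $q\colon QS\to S$ of the unit and every cofibrant $X$, the maps $q\wedge X$ and $X\wedge q$ are weak equivalences. Assume that $\mathcal M$ is stable, i.e. it has a zero object $\star$ and the suspension functor, which sends $X$ to the homotopy pushout of $\star\leftarrow X\to\star$, is an equivalence $\mathrm{Ho}(\mathcal M)\to\mathrm{Ho}(\mathcal M)$. For a finite poset $C$ let $\mathrm{Ho}(\mathcal M^C)$ be the localization of $\mathcal M^C$ at the vertexwise weak equivalences, and let $I=\{0<1\}$ and $V=\{(1,0)\leftarrow(0,0)\to(0,1)\}$. Let $\operatorname{hocolim}_V\colon \mathrm{Ho}(\mathcal M^V)\to\mathrm{Ho}(\mathcal M)$ be the total left derived functor of $\operatorname{colim}_V$, and define $$\operatorname{cone}\colon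 \mathrm{Ho}(\mathcal M^I)\to\mathrm{Ho}(\mathcal M),\qquad \operatorname{cone}(X\xrightarrow{f}Y)=\operatorname{hocolim}_V\big(\star\leftarrow X\xrightarrow{f}Y\big).$$ Let $\wedge^L\colon \mathrm{Ho}(\mathcal M)\times\mathrm{Ho}(\mathcal M)\to\mathrm{Ho}(\mathcal M)$ and $\Box^L\colon \mathrm{Ho}(\mathcal M^I)\times\mathrm{Ho}(\mathcal M^I)\to\mathrm{Ho}(\mathcal M^I)$ be the total left derived functors of $\wedge$ and $\Box$. Then the derived functors $\operatorname{hocolim}_V$, $\wedge^L$ and $\Box^L$ exist, and there is an isomorphism $$\operatorname{cone}(-)\wedge^L\operatorname{cone}(-)\;\cong\;\operatorname{cone}(-\,\Box^L\,-)$$ of functors $\mathrm{Ho}(\mathcal M^I)\times\mathrm{Ho}(\mathcal M^I)\to\mathrm{Ho}(\mathcal M)$. -/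

import Mathlib

open CategoryTheory CategoryTheory.Limits CategoryTheory.MonoidalCategory HomotopicalAlgebra

universe v u

namespace StableCone

noncomputable section

/-! ### Homotopy categories of a model category and of diagrams in it -/

/-- The homotopy category `Ho(M)`: the localization of `M` at its weak equivalences. -/
abbrev Ho (M : Type u) [Category.{v} M] [ModelCategory M] :=
  (weakEquivalences M).Localization

/-- The localization functor `M ⥤ Ho(M)`. -/
abbrev Ho.Q (M : Type u) [Category.{v} M] [ModelCategory M] : M ⥤ Ho M :=
  (weakEquivalences M).Q

/-- The weak equivalences of arrows: commutative squares whose two components are weak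
equivalences. -/
abbrev arrowW (M : Type u) [Category.{v} M] [ModelCategory M] : MorphismProperty (Arrow M) :=
  (weakEquivalences M).arrow

/-- The homotopy category `Ho(M^{0 < 1})` of arrows of `M`. -/
abbrev HoArrow (M : Type u) [Category.{v} M] [ModelCategory M] :=
  (arrowW M).Localization

/-- The vertexwise weak equivalences of `J`-shaped diagrams. -/
abbrev diagramW (J : Type) [Category.{0} J] (M : Type u) [Category.{v} M] [ModelCategory M] :
    MorphismProperty (J ⥤ M) :=
  (weakEquivalences M).functorCategory J

/-- The homotopy category `Ho(M^J)` of `J`-shaped diagrams in `M`. -/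
abbrev HoDiagram (J : Type) [Category.{0} J] (M : Type u) [Category.{v} M] [ModelCategory M] :=
  (diagramW J M).Localization

/-! ### Homotopy colimits -/

/-- The functor `colim : M^J ⥤ M` has a total left derived functor `Ho(M^J) ⥤ Ho(M)`. -/
abbrev HasHocolim (J : Type) [Category.{0} J] (M : Type u) [Category.{v} M] [ModelCategory M]
    [HasColimitsOfShape J M] : Prop :=
  ((colim : (J ⥤ M) ⥤ M) ⋙ Ho.Q M).HasLeftDerivedFunctor (diagramW J M)

/-- The homotopy colimit `hocolim : Ho(M^J) ⥤ Ho(M)`: the total left derived functor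
of `colim`. -/
def hocolim (J : Type) [Category.{0} J] (M : Type u) [Category.{v} M] [ModelCategory M]
    [HasColimitsOfShape J M] [HasHocolim J M] : HoDiagram J M ⥤ Ho M :=
  ((colim : (J ⥤ M) ⥤ M) ⋙ Ho.Q M).totalLeftDerived (diagramW J M).Q (diagramW J M)

/-! ### The cone -/

open scoped ZeroObject

/-- The strict functor from arrows to spans that sends `f : X ⟶ Y` to the "cokernel diagram"
`0 ⟵ X ⟶ Y`, whose second leg is `f`. -/
def cokernelDiagram (M : Type u) [Category.{v} M] [HasZeroObject M] :
    Arrow M ⥤ (WalkingSpan ⥤ M) where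
  obj f := span ((isZero_zero M).from_ f.left : f.left ⟶ (0 : M)) f.hom
  map φ := spanHomMk φ.left (𝟙 (0 : M)) φ.right
    ((isZero_zero M).eq_of_tgt _ _) φ.w.symm
  map_id f := by
    ext (_ | _ | _)
    · rfl
    · rfl
    · rfl
  map_comp φ ψ := by
    ext (_ | _ | _)
    · rfl
    · exact (isZero_zero M).eq_of_tgt _ _
    · rfl

/-- `cokernelDiagram` preserves weak equivalences. -/
lemma cokernelDiagram_inverts (M : Type u) [Category.{v} M] [ModelCategory M] [HasZeroObject M] :
    (arrowW M).IsInvertedBy (cokernelDiagram M ⋙ (diagramW WalkingSpan M).Q) := by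
  intro f g φ hφ
  refine Localization.inverts (diagramW WalkingSpan M).Q (diagramW WalkingSpan M) _ ?_
  rintro (_ | _ | _)
  · exact hφ.1
  · exact (weakEquivalences M).id_mem (0 : M)
  · exact hφ.2

/-- The functor `Ho(M^{0 < 1}) ⥤ Ho(M^{· ← · → ·})` induced by `cokernelDiagram`. -/
def hoCokernelDiagram (M : Type u) [Category.{v} M] [ModelCategory M] [HasZeroObject M] :
    HoArrow M ⥤ HoDiagram WalkingSpan M :=
  Localization.lift (cokernelDiagram M ⋙ (diagramW WalkingSpan M).Q)
    (cokernelDiagram_inverts M) (arrowW M).Q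

/-- Franke's cone functor `Ho(M^{0 < 1}) ⥤ Ho(M)`: the homotopy colimit of the
cokernel diagram. -/
def cone (M : Type u) [Category.{v} M] [ModelCategory M] [HasZeroObject M]
    [HasHocolim WalkingSpan M] : HoArrow M ⥤ Ho M :=
  hoCokernelDiagram M ⋙ hocolim WalkingSpan M

/-! ### Stability -/

/-- The strict functor that sends an object `X` to the arrow `X ⟶ 0`. -/
def toZero (M : Type u) [Category.{v} M] [HasZeroObject M] : M ⥤ Arrow M where
  obj X := Arrow.mk ((isZero_zero M).from_ X : X ⟶ (0 : M))
  map φ := Arrow.homMk φ (𝟙 (0 : M)) ((isZero_zero M).eq_of_tgt _ _)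
  map_id _ := by ext <;> simp
  map_comp _ _ := by ext <;> simp

/-- `toZero` preserves weak equivalences. -/
lemma toZero_inverts (M : Type u) [Category.{v} M] [ModelCategory M] [HasZeroObject M] :
    (weakEquivalences M).IsInvertedBy (toZero M ⋙ (arrowW M).Q) := by
  intro X Y φ hφ
  exact Localization.inverts (arrowW M).Q (arrowW M) _
    ⟨hφ, (weakEquivalences M).id_mem (0 : M)⟩

/-- The suspension functor `Ho(M) ⥤ Ho(M)`: `Σ X` is the cone of `X ⟶ 0`, that is, the homotopy
pushout of `0 ⟵ X ⟶ 0`. -/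
def suspension (M : Type u) [Category.{v} M] [ModelCategory M] [HasZeroObject M]
    [HasHocolim WalkingSpan M] : Ho M ⥤ Ho M :=
  Localization.lift (toZero M ⋙ (arrowW M).Q) (toZero_inverts M) (Ho.Q M) ⋙ cone M

/-- A pointed model category is stable if the suspension functor on its homotopy category
is an equivalence. (The homotopy pushout functor by which the suspension is defined always exists;
its existence is not part of this assumption.) -/
class IsStable (M : Type u) [Category.{v} M] [ModelCategory M] [HasZeroObject M] : Prop where
  isEquivalence_suspension : ∀ [HasHocolim WalkingSpan M], (suspension M).IsEquivalence

/-! ### Monoidal model categories -/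

/-- The pushout-product of `f : X ⟶ Y` and `g : U ⟶ V`: the canonical map from the pushout of
`X ⊗ V` and `Y ⊗ U` under `X ⊗ U` to `Y ⊗ V`. -/
abbrev pushoutProductHom {M : Type u} [Category.{v} M] [ModelCategory M] [MonoidalCategory M]
    {X Y U V : M} (f : X ⟶ Y) (g : U ⟶ V) :=
  ((MonoidalCategory.Arrow.pushoutProduct.obj (Arrow.mk f)).obj (Arrow.mk g)).hom

/-- A monoidal model category: a model category with functorial factorizations and a closed
monoidal structure that satisfies the pushout-product axiom and the unit axiom.
The monoidal structure need not be symmetric. -/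
class IsMonoidalModelCategory (M : Type u) [Category.{v} M] [ModelCategory M]
    [MonoidalCategory M] : Prop where
  closed_left (X : M) : (tensorLeft X).IsLeftAdjoint
  closed_right (X : M) : (tensorRight X).IsLeftAdjoint
  functorial_factorization₁ :
    (trivialCofibrations M).HasFunctorialFactorization (fibrations M)
  functorial_factorization₂ :
    (cofibrations M).HasFunctorialFactorization (trivialFibrations M)
  cofibration_pushoutProduct {X Y U V : M} (f : X ⟶ Y) (g : U ⟶ V)
    [Cofibration f] [Cofibration g] : Cofibration (pushoutProductHom f g)
  weakEquivalence_pushoutProduct_left {X Y U V : M} (f : X ⟶ Y) (g : U ⟶ V)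
    [Cofibration f] [Cofibration g] [WeakEquivalence f] :
    WeakEquivalence (pushoutProductHom f g)
  weakEquivalence_pushoutProduct_right {X Y U V : M} (f : X ⟶ Y) (g : U ⟶ V)
    [Cofibration f] [Cofibration g] [WeakEquivalence g] :
    WeakEquivalence (pushoutProductHom f g)
  /-- For cofibrant `X` and a cofibrant replacement `q : QS ⟶ 𝟙_ M` of the unit, the map
  `q ⊗ X` is a weak equivalence. -/
  unit_left {QS : M} (q : QS ⟶ 𝟙_ M) [IsCofibrant QS] [Fibration q] [WeakEquivalence q]
    (X : M) [IsCofibrant X] : WeakEquivalence (q ▷ X)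
  /-- For cofibrant `X` and a cofibrant replacement `q : QS ⟶ 𝟙_ M` of the unit, the map
  `X ⊗ q` is a weak equivalence. -/
  unit_right {QS : M} (q : QS ⟶ 𝟙_ M) [IsCofibrant QS] [Fibration q] [WeakEquivalence q]
    (X : M) [IsCofibrant X] : WeakEquivalence (X ◁ q)

/-! ### The derived smash product and the derived pushout-product -/

/-- The monoidal product `M × M ⥤ M` has a total left derived functor
`Ho(M) × Ho(M) ⥤ Ho(M)`. -/
abbrev HasDerivedTensor (M : Type u) [Category.{v} M] [ModelCategory M]
    [MonoidalCategory M] : Prop :=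
  (tensor M ⋙ Ho.Q M).HasLeftDerivedFunctor ((weakEquivalences M).prod (weakEquivalences M))

/-- The derived monoidal product `Ho(M) × Ho(M) ⥤ Ho(M)`. -/
def derivedTensor (M : Type u) [Category.{v} M] [ModelCategory M]
    [MonoidalCategory M] [HasDerivedTensor M] : Ho M × Ho M ⥤ Ho M :=
  (tensor M ⋙ Ho.Q M).totalLeftDerived ((Ho.Q M).prod (Ho.Q M))
    ((weakEquivalences M).prod (weakEquivalences M))

/-- The pushout-product as a functor `M^{0 < 1} × M^{0 < 1} ⥤ M^{0 < 1}`. -/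
abbrev pushoutProduct (M : Type u) [Category.{v} M] [ModelCategory M] [MonoidalCategory M] :
    Arrow M × Arrow M ⥤ Arrow M :=
  Functor.uncurry.obj MonoidalCategory.Arrow.pushoutProduct

/-- Vertexwise weak equivalences of arrows contain the identities. -/
instance (M : Type u) [Category.{v} M] [ModelCategory M] :
    (arrowW M).ContainsIdentities where
  id_mem f := ⟨(weakEquivalences M).id_mem f.left, (weakEquivalences M).id_mem f.right⟩

/-- The pushout-product has a total left derived functor
`Ho(M^{0 < 1}) × Ho(M^{0 < 1}) ⥤ Ho(M^{0 < 1})`. -/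
abbrev HasDerivedPushoutProduct (M : Type u) [Category.{v} M] [ModelCategory M]
    [MonoidalCategory M] : Prop :=
  (pushoutProduct M ⋙ (arrowW M).Q).HasLeftDerivedFunctor ((arrowW M).prod (arrowW M))

/-- The derived pushout-product `Ho(M^{0 < 1}) × Ho(M^{0 < 1}) ⥤ Ho(M^{0 < 1})`. -/
def derivedPushoutProduct (M : Type u) [Category.{v} M] [ModelCategory M]
    [MonoidalCategory M] [HasDerivedPushoutProduct M] : HoArrow M × HoArrow M ⥤ HoArrow M :=
  (pushoutProduct M ⋙ (arrowW M).Q).totalLeftDerived ((arrowW M).Q.prod (arrowW M).Q)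
    ((arrowW M).prod (arrowW M))

end

end StableCone

/-! The isomorphism already exists strictly. The strict cofiber of `f` is the cokernel of `f`, and
the tensor product preserves colimits in each variable, so `cofiber f ⊗ cofiber g` is the cokernel
of the pushout-product of `f` and `g` (`isCoker_pushoutProduct`). This identification is natural in
both arrows (`nonempty_cofiberTensorIso`).

It descends to homotopy categories because cofibrations between cofibrant objects compute every
derived functor involved. For such arrows the cone is the strict cofiber, the cofibers are cofibrant
so that their derived tensor product is the strict one, and the pushout-product is again such an
arrow. `LeftDeformation.nonempty_iso` then compares the two sides on replacements.

The homotopical input is that `colim`, `tensor` and `pushoutProduct` respect weak equivalences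
between good objects (`adapted_colim`, `adapted_tensor`, `adapted_pushoutProduct`). It rests on the
gluing lemma, Ken Brown's lemma and the pushout-product axiom; functorial factorizations supply the
replacements. -/

namespace StableCone

/-! ### Left deformations and derived functors -/

section LeftDeformation

universe v₁ v₂ v₃ u₁ u₂ u₃

variable {C : Type u₁} {D : Type u₂} {H : Type u₃} [Category.{v₁} C] [Category.{v₂} D]
  [Category.{v₃} H]

/-- A left deformation for a class `W` of weak equivalences: a functor `R` that preserves weak
equivalences and takes values in good objects, with a natural weak equivalence `R ⟶ 𝟭 C`. -/
structure LeftDeformation (W : MorphismProperty C) where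
  /-- the replacement functor -/
  R : C ⥤ C
  /-- the natural weak equivalence to the identity -/
  ρ : R ⟶ 𝟭 C
  /-- the good objects -/
  good : ObjectProperty C
  good_obj (X : C) : good (R.obj X)
  weq (X : C) : W (ρ.app X)
  map_weq {X Y : C} (f : X ⟶ Y) (hf : W f) : W (R.map f)

namespace LeftDeformation

variable {W : MorphismProperty C} (d : LeftDeformation W)

/-- A functor is adapted to a left deformation if it inverts the weak equivalences between
good objects. -/
def Adapted (F : C ⥤ H) : Prop :=
  ∀ ⦃X Y : C⦄ (f : X ⟶ Y), d.good X → d.good Y → W f → IsIso (F.map f)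

variable {d} {F : C ⥤ H} (hF : d.Adapted F)

include hF in
lemma Adapted.isInvertedBy : W.IsInvertedBy (d.R ⋙ F) :=
  fun _ _ f hf => hF _ (d.good_obj _) (d.good_obj _) (d.map_weq f hf)

variable (L : C ⥤ D) [L.IsLocalization W]

/-- The left derived functor of a functor that is adapted to a left deformation. -/
noncomputable def derived : D ⥤ H :=
  Localization.lift (d.R ⋙ F) hF.isInvertedBy L

/-- The value of the derived functor is computed by the replacement functor. -/
noncomputable def derivedIso : L ⋙ derived hF L ≅ d.R ⋙ F :=
  Localization.fac _ _ _

/-- The counit of the derived functor. -/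
noncomputable def derivedCounit : L ⋙ derived hF L ⟶ F :=
  (derivedIso hF L).hom ≫ Functor.whiskerRight d.ρ F ≫ F.leftUnitor.hom

lemma derivedCounit_app (X : C) :
    (derivedCounit hF L).app X = (derivedIso hF L).hom.app X ≫ F.map (d.ρ.app X) := by
  simp [derivedCounit]

lemma isIso_derivedCounit_app (X : C) (hX : d.good X) :
    IsIso ((derivedCounit hF L).app X) := by
  have := hF _ (d.good_obj X) hX (d.weq X)
  rw [derivedCounit_app]
  infer_instance

/-- Each `X` is joined to the good object `R X` by a map that `L` inverts, and the counit is
invertible at good objects. Transformations into the derived functor can therefore be built and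
compared on replacements. -/
lemma isLeftDerivedFunctor_derived :
    (derived hF L).IsLeftDerivedFunctor (derivedCounit hF L) W := by
  have hR (X : C) : IsIso ((derivedCounit hF L).app (d.R.obj X)) :=
    isIso_derivedCounit_app hF L _ (d.good_obj X)
  have hL (X : C) : IsIso (L.map (d.ρ.app X)) := Localization.inverts L W _ (d.weq X)
  let e : d.R ⋙ L ⟶ L := Functor.whiskerRight d.ρ L ≫ L.leftUnitor.hom
  have he (X : C) : e.app X = L.map (d.ρ.app X) := by simp [e]
  have (X : C) : IsIso (e.app X) := by rw [he]; infer_instance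
  have : IsIso e := NatIso.isIso_of_isIso_app e
  let c : d.R ⋙ L ⋙ derived hF L ⟶ d.R ⋙ F := Functor.whiskerLeft d.R (derivedCounit hF L)
  have : IsIso c := by
    have (X : C) : IsIso (c.app X) := hR X
    exact NatIso.isIso_of_isIso_app c
  -- Pass from `X` back to `R X`, apply `β` there, invert the counit at the good object `R X`, and
  -- return along `e`.
  let δ (G : D ⥤ H) (β : L ⋙ G ⟶ F) : L ⋙ G ⟶ L ⋙ derived hF L :=
    Functor.whiskerRight (inv e) G ≫ (Functor.associator _ _ _).hom ≫ Functor.whiskerLeft d.R β ≫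
      inv c ≫ (Functor.associator _ _ _).inv ≫ Functor.whiskerRight e (derived hF L)
  have hδ (G : D ⥤ H) (β : L ⋙ G ⟶ F) (X : C) :
      (δ G β).app X ≫ (derivedCounit hF L).app X = β.app X := by
    have h₁ := (derivedCounit hF L).naturality (d.ρ.app X)
    have h₂ : inv (c.app X) ≫ (derivedCounit hF L).app (d.R.obj X) = 𝟙 _ :=
      IsIso.inv_hom_id (c.app X)
    have h₃ := β.naturality (d.ρ.app X)
    dsimp at h₁ h₃
    simp only [δ, NatTrans.comp_app, Functor.whiskerRight_app, Functor.whiskerLeft_app,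
      Functor.associator_hom_app, Functor.associator_inv_app, Category.id_comp, Category.assoc,
      NatIso.isIso_inv_app, he, h₁]
    rw [reassoc_of% h₂, ← h₃, ← G.map_comp_assoc, IsIso.inv_hom_id, G.map_id, Category.id_comp]
  have ext_aux {G : D ⥤ H} {γ₁ γ₂ : G ⟶ derived hF L}
      (h : ∀ X, γ₁.app (L.obj X) ≫ (derivedCounit hF L).app X =
        γ₂.app (L.obj X) ≫ (derivedCounit hF L).app X) : γ₁ = γ₂ := by
    refine Localization.natTrans_ext L W fun X => ?_
    have hX : γ₁.app (L.obj (d.R.obj X)) = γ₂.app (L.obj (d.R.obj X)) :=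
      (cancel_mono _).1 (h (d.R.obj X))
    refine (cancel_epi (G.map (L.map (d.ρ.app X)))).1 ?_
    exact (γ₁.naturality _).trans ((congrArg (· ≫ _) hX).trans (γ₂.naturality _).symm)
  let lift (G : D ⥤ H) (β : L ⋙ G ⟶ F) : G ⟶ derived hF L :=
    Localization.liftNatTrans L W (L ⋙ G) (L ⋙ derived hF L) G (derived hF L) (δ G β)
  have hlift (G : D ⥤ H) (β : L ⋙ G ⟶ F) (X : C) :
      (lift G β).app (L.obj X) ≫ (derivedCounit hF L).app X = β.app X := by
    simpa [lift] using hδ G β X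
  refine ⟨⟨⟨IsTerminal.ofUniqueHom
    (Y := Functor.RightExtension.mk (derived hF L) (derivedCounit hF L))
    (fun E => CostructuredArrow.homMk (lift E.left E.hom) ?_) ?_⟩⟩⟩
  · ext X
    exact hlift E.left E.hom X
  · intro E m
    ext1
    exact ext_aux fun X => (NatTrans.congr_app (CostructuredArrow.w m) X).trans
      (hlift E.left E.hom X).symm

include hF in
lemma Adapted.hasLeftDerivedFunctor : F.HasLeftDerivedFunctor W :=
  have := isLeftDerivedFunctor_derived hF W.Q
  Functor.HasLeftDerivedFunctor.mk' (derived hF W.Q) (derivedCounit hF W.Q)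

include hF in
/-- The counit of any left derived functor of an adapted functor is an isomorphism at good
objects. -/
lemma Adapted.isIso_counit_app {L : C ⥤ D} [L.IsLocalization W] (LF : D ⥤ H) (α : L ⋙ LF ⟶ F)
    [LF.IsLeftDerivedFunctor α W] (X : C) (hX : d.good X) : IsIso (α.app X) := by
  have := isLeftDerivedFunctor_derived hF L
  have := isIso_derivedCounit_app hF L X hX
  let e := Functor.leftDerivedUnique (derived hF L) LF α (derivedCounit hF L) W
  have h : e.hom.app (L.obj X) ≫ (derivedCounit hF L).app X = α.app X := by
    simp [e]
  rw [← h]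
  infer_instance

/-- The product of two left deformations. -/
def prod {C' : Type u₂} [Category.{v₂} C'] {W' : MorphismProperty C'} (d : LeftDeformation W)
    (d' : LeftDeformation W') : LeftDeformation (W.prod W') where
  R := d.R.prod d'.R
  ρ := NatTrans.prod d.ρ d'.ρ
  good X := d.good X.1 ∧ d'.good X.2
  good_obj X := ⟨d.good_obj X.1, d'.good_obj X.2⟩
  weq X := ⟨d.weq X.1, d'.weq X.2⟩
  map_weq f hf := ⟨d.map_weq f.1 hf.1, d'.map_weq f.2 hf.2⟩

end LeftDeformation
end LeftDeformation

/-! ### Ken Brown's lemma and the gluing lemma -/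

section Homotopy

attribute [local simp] pushout.inl_desc pushout.inr_desc pushout.inl_desc_assoc
  pushout.inr_desc_assoc pullback.lift_fst pullback.lift_snd coprod.inl_desc_assoc
  coprod.inr_desc_assoc coprod.inl_desc coprod.inr_desc

variable {M : Type u} [Category.{v} M] [ModelCategory M]

/-- Ken Brown's lemma. -/
lemma weakEquivalence_map_of_isCofibrant (F : M ⥤ M)
    (hF : ∀ ⦃X Y : M⦄ (f : X ⟶ Y) [IsCofibrant X] [IsCofibrant Y] [Cofibration f]
      [WeakEquivalence f], WeakEquivalence (F.map f))
    {X Y : M} (f : X ⟶ Y) [IsCofibrant X] [IsCofibrant Y] [WeakEquivalence f] :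
    WeakEquivalence (F.map f) := by
  obtain ⟨h⟩ := (inferInstance : Nonempty (CofibrantBrownFactorization f))
  have : IsCofibrant h.Z := isCofibrant_of_cofibration h.s
  have := hF h.i
  have := hF h.s
  -- The hypothesis on `F` does not apply to `p`, but it applies to the section `s`;
  -- two-out-of-three does the rest.
  have : WeakEquivalence (F.map h.p) :=
    weakEquivalence_of_precomp_of_fac (f := F.map h.s) (fg := 𝟙 _)
      (by rw [← F.map_comp, h.s_p, F.map_id])
  rw [← h.fac, F.map_comp]
  infer_instance

lemma trivialCofibration_iff_llp {X Y : M} (f : X ⟶ Y) :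
    trivialCofibrations M f ↔ (fibrations M).llp f := by
  rw [fibrations_llp]

/-- The map induced on pushouts by a trivial Reedy cofibration of spans `A ← X → B`. -/
lemma trivialCofibration_pushoutMap {A X B A' X' B' : M} (a : X ⟶ A) (b : X ⟶ B)
    (a' : X' ⟶ A') (b' : X' ⟶ B') (fA : A ⟶ A') (fB : B ⟶ B') (fX : X ⟶ X')
    (ha : a ≫ fA = fX ≫ a') (hb : b ≫ fB = fX ≫ b')
    [Cofibration fA] [WeakEquivalence fA]
    (hB : trivialCofibrations M (pushout.desc fB b' hb)) :
    trivialCofibrations M (pushout.map a b a' b' fA fB fX ha hb) := by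
  rw [trivialCofibration_iff_llp] at hB ⊢
  intro E Z p hp
  have hp' : Fibration p := (fibration_iff p).2 hp
  have := hB p hp
  constructor
  intro t s sq
  have h := sq.w
  -- The lift is first chosen on `A'`. It prescribes a value on `X'`, and the relative latching map
  -- `B ⊔_X X' ⟶ B'` allows a lift on `B'` with this value.
  have sqA : CommSq (pushout.inl a b ≫ t) fA p (pushout.inl a' b' ≫ s) := ⟨by
    simpa using pushout.inl a b ≫= h⟩
  have sqB : CommSq (pushout.desc (f := b) (g := fX) (pushout.inr a b ≫ t) (a' ≫ sqA.lift) (by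
      rw [← reassoc_of% ha, sqA.fac_left, pushout.condition_assoc])) (pushout.desc fB b' hb) p
      (pushout.inr a' b' ≫ s) := ⟨by
    ext
    · simpa using pushout.inr a b ≫= h
    · simp [pushout.condition_assoc]⟩
  have hl : pushout.inl b fX ≫ pushout.desc fB b' hb ≫ sqB.lift = pushout.inr a b ≫ t := by
    rw [sqB.fac_left, pushout.inl_desc]
  have hr : pushout.inr b fX ≫ pushout.desc fB b' hb ≫ sqB.lift = a' ≫ sqA.lift := by
    rw [sqB.fac_left, pushout.inr_desc]
  rw [pushout.inl_desc_assoc] at hl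
  rw [pushout.inr_desc_assoc] at hr
  exact ⟨⟨{ l := pushout.desc sqA.lift sqB.lift hr.symm
            fac_left := by ext <;> simp [hl]
            fac_right := by ext <;> simp }⟩⟩

/-- The gluing lemma. -/
theorem weakEquivalence_pushoutMap {A X B A' X' B' : M} (a : X ⟶ A) (b : X ⟶ B)
    (a' : X' ⟶ A') (b' : X' ⟶ B') (fA : A ⟶ A') (fB : B ⟶ B') (fX : X ⟶ X')
    (ha : a ≫ fA = fX ≫ a') (hb : b ≫ fB = fX ≫ b')
    [IsCofibrant A] [IsCofibrant A'] [IsCofibrant X] [IsCofibrant X']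
    [Cofibration b] [Cofibration b']
    [WeakEquivalence fA] [WeakEquivalence fB] [WeakEquivalence fX] :
    WeakEquivalence (pushout.map a b a' b' fA fB fX ha hb) := by
  -- Brown's argument for spans: the map of spans is factored as a trivial Reedy cofibration
  -- followed by a map with a section that is also one. The middle span `hA.Z ← φ.Z → ψ.Z` is built
  -- vertex by vertex.
  obtain ⟨hA⟩ := (inferInstance : Nonempty (CofibrantBrownFactorization fA))
  let T := pullback a' hA.p
  let k : X ⨿ X' ⟶ T := coprod.desc (pullback.lift fX (a ≫ hA.i) (by simp [ha]))
    (pullback.lift (𝟙 X') (a' ≫ hA.s) (by simp))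
  let φ := MorphismProperty.factorizationData (cofibrations M) (trivialFibrations M) k
  let iX : X ⟶ φ.Z := coprod.inl ≫ φ.i
  let sX : X' ⟶ φ.Z := coprod.inr ≫ φ.i
  let pX : φ.Z ⟶ X' := φ.p ≫ pullback.fst _ _
  let c : φ.Z ⟶ hA.Z := φ.p ≫ pullback.snd _ _
  have iX_pX : iX ≫ pX = fX := by simp [iX, pX, k]
  have sX_pX : sX ≫ pX = 𝟙 X' := by simp [sX, pX, k]
  have iX_c : iX ≫ c = a ≫ hA.i := by simp [iX, c, k]
  have sX_c : sX ≫ c = a' ≫ hA.s := by simp [sX, c, k]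
  have c_p : c ≫ hA.p = pX ≫ a' := by simp [c, pX, pullback.condition]
  -- `pX` is a trivial fibration followed by the base change of the trivial fibration `hA.p`.
  have : WeakEquivalence pX := inferInstance
  have : WeakEquivalence iX := weakEquivalence_of_postcomp_of_fac iX_pX
  have : WeakEquivalence sX := weakEquivalence_of_postcomp_of_fac sX_pX
  have : Cofibration iX := inferInstance
  have : Cofibration sX := inferInstance
  -- the relative latching object of the third vertex
  let E := pushout b iX
  let E' := pushout b' sX
  let E₂ := pushout (pushout.inr b iX) (pushout.inr b' sX)
  let jE : E ⟶ E₂ := pushout.inl _ _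
  let jE' : E' ⟶ E₂ := pushout.inr _ _
  have : Cofibration jE := inferInstance
  have : Cofibration jE' := inferInstance
  let q : E₂ ⟶ B' := pushout.desc (pushout.desc fB (pX ≫ b') (by rw [reassoc_of% iX_pX, hb]))
    (pushout.desc (𝟙 B') (pX ≫ b') (by rw [reassoc_of% sX_pX, Category.comp_id])) (by simp)
  -- `E₂` contains the relative latching objects of both `iB` and `sB`, so one factorization makes
  -- both relative latching maps cofibrations.
  let ψ := MorphismProperty.factorizationData (cofibrations M) (trivialFibrations M) q
  let iB : B ⟶ ψ.Z := pushout.inl b iX ≫ jE ≫ ψ.i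
  let sB : B' ⟶ ψ.Z := pushout.inl b' sX ≫ jE' ≫ ψ.i
  let bC : φ.Z ⟶ ψ.Z := pushout.inr b iX ≫ jE ≫ ψ.i
  have iB_p : iB ≫ ψ.p = fB := by simp [iB, jE, q]
  have sB_p : sB ≫ ψ.p = 𝟙 B' := by simp [sB, jE', q]
  have bC_p : bC ≫ ψ.p = pX ≫ b' := by simp [bC, jE, q]
  have hbi : b ≫ iB = iX ≫ bC := by simp [iB, bC, pushout.condition_assoc]
  have hbs : b' ≫ sB = sX ≫ bC := by
    simp [sB, bC, jE, jE', pushout.condition_assoc]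
  have hbC : bC = pushout.inr b' sX ≫ jE' ≫ ψ.i := by
    simp [bC, jE, jE', pushout.condition_assoc]
  have h₁ : trivialCofibrations M (pushout.desc iB bC hbi) := by
    have e : pushout.desc iB bC hbi = jE ≫ ψ.i := by ext <;> simp [iB, bC]
    rw [mem_trivialCofibrations_iff, e]
    refine ⟨inferInstance, ?_⟩
    have : WeakEquivalence (pushout.inl b iX ≫ jE ≫ ψ.i) :=
      weakEquivalence_of_postcomp_of_fac iB_p
    exact weakEquivalence_of_precomp (pushout.inl b iX) _
  have h₂ : trivialCofibrations M (pushout.desc sB bC hbs) := by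
    have e : pushout.desc sB bC hbs = jE' ≫ ψ.i := by ext <;> simp [sB, hbC]
    rw [mem_trivialCofibrations_iff, e]
    refine ⟨inferInstance, ?_⟩
    have : WeakEquivalence (pushout.inl b' sX ≫ jE' ≫ ψ.i) :=
      weakEquivalence_of_postcomp_of_fac sB_p
    exact weakEquivalence_of_precomp (pushout.inl b' sX) _
  have w₁ := ((mem_trivialCofibrations_iff _).1
    (trivialCofibration_pushoutMap a b c bC hA.i iB iX iX_c.symm hbi h₁)).2
  have w₂ := ((mem_trivialCofibrations_iff _).1
    (trivialCofibration_pushoutMap a' b' c bC hA.s sB sX sX_c.symm hbs h₂)).2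
  have w₃ : WeakEquivalence (pushout.map c bC a' b' hA.p ψ.p pX c_p bC_p) :=
    weakEquivalence_of_precomp_of_fac (fg := 𝟙 _)
      (f := pushout.map a' b' c bC hA.s sB sX sX_c.symm hbs) (by ext <;> simp [reassoc_of% sB_p])
  have e : pushout.map a b a' b' fA fB fX ha hb =
      pushout.map a b c bC hA.i iB iX iX_c.symm hbi ≫
        pushout.map c bC a' b' hA.p ψ.p pX c_p bC_p := by ext <;> simp [reassoc_of% iB_p]
  rw [e]
  infer_instance

end Homotopy

/-! ### Functorial replacements of objects, arrows and spans -/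

section Replacement

variable {M : Type u} [Category.{v} M] [ModelCategory M]
  (φ : (cofibrations M).FunctorialFactorizationData (trivialFibrations M))

/-- The functor that sends an object to the morphism from the initial object. -/
noncomputable def fromInitial (M : Type u) [Category.{v} M] [HasInitial M] : M ⥤ Arrow M where
  obj X := Arrow.mk (initial.to X)
  map f := Arrow.homMk (𝟙 _) f (by simp)

/-- The second factors are weak equivalences, so by two-out-of-three only the target component of
`τ` matters. -/
lemma weakEquivalence_factorization_map {f g : Arrow M} (τ : f ⟶ g)
    (hτ : weakEquivalences M τ.right) : weakEquivalences M (φ.Z.map τ) := by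
  have h : φ.Z.map τ ≫ φ.p.app g = φ.p.app f ≫ τ.right := φ.p.naturality τ
  refine (weakEquivalences M).of_postcomp _ _ (φ.hp g).2 ?_
  rw [h]
  exact (weakEquivalences M).comp_mem _ _ (φ.hp f).2 hτ

/-- The functorial cofibrant replacement. -/
noncomputable def cofibrantReplacement : LeftDeformation (weakEquivalences M) where
  R := fromInitial M ⋙ φ.Z
  ρ := Functor.whiskerLeft (fromInitial M) φ.p
  good X := IsCofibrant X
  good_obj X := by
    have : Cofibration (φ.i.app (Arrow.mk (initial.to X))) := (cofibration_iff _).2 (φ.hi _)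
    exact (isCofibrant_iff_of_isInitial (φ.i.app (Arrow.mk (initial.to X)))
      initialIsInitial).2 this
  weq X := (φ.hp _).2
  map_weq f hf := weakEquivalence_factorization_map φ _ hf

/-- The functor that precomposes an arrow with the cofibrant replacement of its source. -/
noncomputable def replaceSource : Arrow M ⥤ Arrow M where
  obj f := Arrow.mk ((cofibrantReplacement φ).ρ.app f.left ≫ f.hom)
  map τ := Arrow.homMk ((cofibrantReplacement φ).R.map τ.left) τ.right (by
    have h := (cofibrantReplacement φ).ρ.naturality τ.left
    dsimp at h ⊢
    rw [reassoc_of% h, Category.assoc, Arrow.w])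
  map_id f := by ext <;> simp
  map_comp τ τ' := by ext <;> simp

/-- The functorial replacement of an arrow by a cofibration between cofibrant objects. -/
noncomputable def arrowReplacement : LeftDeformation (arrowW M) where
  R :=
    { obj f := Arrow.mk (φ.i.app ((replaceSource φ).obj f))
      map τ := Arrow.homMk ((cofibrantReplacement φ).R.map τ.left)
        (φ.Z.map ((replaceSource φ).map τ)) (φ.i.naturality ((replaceSource φ).map τ))
      map_id f := by
        ext
        · exact (cofibrantReplacement φ).R.map_id _
        · exact (congrArg φ.Z.map ((replaceSource φ).map_id _)).trans (φ.Z.map_id _)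
      map_comp τ τ' := by
        ext
        · exact (cofibrantReplacement φ).R.map_comp _ _
        · exact (congrArg φ.Z.map ((replaceSource φ).map_comp _ _)).trans (φ.Z.map_comp _ _) }
  ρ :=
    { app f := Arrow.homMk ((cofibrantReplacement φ).ρ.app f.left)
        (φ.p.app ((replaceSource φ).obj f)) (φ.fac_app (f := (replaceSource φ).obj f)).symm
      naturality f g τ := by
        ext
        · exact (cofibrantReplacement φ).ρ.naturality τ.left
        · exact φ.p.naturality ((replaceSource φ).map τ) }
  good f := IsCofibrant f.left ∧ Cofibration f.hom
  good_obj f := ⟨(cofibrantReplacement φ).good_obj f.left, (cofibration_iff _).2 (φ.hi _)⟩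
  weq f := ⟨(cofibrantReplacement φ).weq f.left, (φ.hp _).2⟩
  map_weq τ hτ := ⟨(cofibrantReplacement φ).map_weq _ hτ.1,
    weakEquivalence_factorization_map φ _ hτ.2⟩

/-- The second leg of a span. -/
def spanSnd : (WalkingSpan ⥤ M) ⥤ Arrow M where
  obj S := Arrow.mk (S.map WalkingSpan.Hom.snd)
  map τ := Arrow.homMk (τ.app .zero) (τ.app .right) (τ.naturality _).symm

/-- The functorial replacement of a span by a span of cofibrant objects whose second leg is a
cofibration. -/
noncomputable def spanReplacement : LeftDeformation (diagramW WalkingSpan M) where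
  R :=
    -- The two legs fit together because `arrowReplacement` replaces the source of an arrow by
    -- exactly its `cofibrantReplacement`.
    { obj S := span ((cofibrantReplacement φ).R.map (S.map WalkingSpan.Hom.fst))
        ((arrowReplacement φ).R.obj (spanSnd.obj S)).hom
      map {S S'} τ := spanHomMk ((cofibrantReplacement φ).R.map (τ.app .zero))
        ((cofibrantReplacement φ).R.map (τ.app .left))
        ((arrowReplacement φ).R.map (spanSnd.map τ)).right
        (((cofibrantReplacement φ).R.map_comp _ _).symm.trans
          ((congrArg _ (τ.naturality _)).trans ((cofibrantReplacement φ).R.map_comp _ _)))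
        (((arrowReplacement φ).R.map (spanSnd.map τ)).w.symm)
      map_id S := by
        ext (_ | _ | _)
        · exact (cofibrantReplacement φ).R.map_id _
        · exact (cofibrantReplacement φ).R.map_id _
        · exact congrArg Arrow.Hom.right ((arrowReplacement φ).R.map_id (spanSnd.obj S))
      map_comp τ τ' := by
        ext (_ | _ | _)
        · exact (cofibrantReplacement φ).R.map_comp _ _
        · exact (cofibrantReplacement φ).R.map_comp _ _
        · exact congrArg Arrow.Hom.right
            ((arrowReplacement φ).R.map_comp (spanSnd.map τ) (spanSnd.map τ')) }
  ρ :=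
    { app S := spanHomMk (F := span _ _) ((cofibrantReplacement φ).ρ.app (S.obj .zero))
        ((cofibrantReplacement φ).ρ.app (S.obj .left))
        ((arrowReplacement φ).ρ.app (spanSnd.obj S)).right
        ((cofibrantReplacement φ).ρ.naturality (S.map WalkingSpan.Hom.fst))
        (((arrowReplacement φ).ρ.app (spanSnd.obj S)).w.symm)
      naturality S S' τ := by
        ext (_ | _ | _)
        · exact (cofibrantReplacement φ).ρ.naturality _
        · exact (cofibrantReplacement φ).ρ.naturality _
        · exact congrArg Arrow.Hom.right ((arrowReplacement φ).ρ.naturality (spanSnd.map τ)) }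
  -- The gluing lemma needs only one leg to be a cofibration. With this choice the cokernel diagram
  -- of a good arrow is already a good span.
  good S := IsCofibrant (S.obj .left) ∧ IsCofibrant (S.obj .zero) ∧
    Cofibration (S.map WalkingSpan.Hom.snd)
  good_obj S := ⟨(cofibrantReplacement φ).good_obj _, (cofibrantReplacement φ).good_obj _,
    ((arrowReplacement φ).good_obj (spanSnd.obj S)).2⟩
  weq S := by
    rintro (_ | _ | _)
    · exact (cofibrantReplacement φ).weq _
    · exact (cofibrantReplacement φ).weq _
    · exact ((arrowReplacement φ).weq (spanSnd.obj S)).2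
  map_weq τ hτ := by
    rintro (_ | _ | _)
    · exact (cofibrantReplacement φ).map_weq _ (hτ _)
    · exact (cofibrantReplacement φ).map_weq _ (hτ _)
    · exact ((arrowReplacement φ).map_weq (spanSnd.map τ) ⟨hτ _, hτ _⟩).2

end Replacement

/-! ### Homotopy invariance of pushouts of good spans -/

section Colimit

variable {M : Type u} [Category.{v} M] [ModelCategory M]

/-- This is the gluing lemma, transported along `diagramIsoSpan` from literal spans to arbitrary
functors. -/
lemma weakEquivalence_colim_map {S S' : WalkingSpan ⥤ M} (τ : S ⟶ S')
    (h : diagramW WalkingSpan M τ)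
    [IsCofibrant (S.obj .left)] [IsCofibrant (S.obj .zero)]
    [Cofibration (S.map WalkingSpan.Hom.snd)]
    [IsCofibrant (S'.obj .left)] [IsCofibrant (S'.obj .zero)]
    [Cofibration (S'.map WalkingSpan.Hom.snd)] : weakEquivalences M (colim.map τ) := by
  have w (j) : WeakEquivalence (τ.app j) := (weakEquivalence_iff _).2 (h j)
  have key := weakEquivalence_pushoutMap (S.map WalkingSpan.Hom.fst) (S.map WalkingSpan.Hom.snd)
    (S'.map WalkingSpan.Hom.fst) (S'.map WalkingSpan.Hom.snd) (τ.app .left) (τ.app .right)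
    (τ.app .zero) (τ.naturality _) (τ.naturality _)
  rw [weakEquivalence_iff] at key
  let σ := (diagramIsoSpan S).inv ≫ τ ≫ (diagramIsoSpan S').hom
  have hσ : colim.map σ = pushout.map (S.map WalkingSpan.Hom.fst) (S.map WalkingSpan.Hom.snd)
      (S'.map WalkingSpan.Hom.fst) (S'.map WalkingSpan.Hom.snd) (τ.app .left) (τ.app .right)
      (τ.app .zero) (τ.naturality _) (τ.naturality _) := by
    refine pushout.hom_ext ?_ ?_
    · refine (ι_colimMap σ WalkingSpan.left).trans ?_
      have h' : σ.app .left = τ.app .left := (Category.id_comp _).trans (Category.comp_id _)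
      rw [h', pushout.inl_desc]
      rfl
    · refine (ι_colimMap σ WalkingSpan.right).trans ?_
      have h' : σ.app .right = τ.app .right := (Category.id_comp _).trans (Category.comp_id _)
      rw [h', pushout.inr_desc]
      rfl
  rw [← hσ] at key
  refine ((weakEquivalences M).arrow_mk_iso_iff (Arrow.isoMk (colim.mapIso (diagramIsoSpan S))
    (colim.mapIso (diagramIsoSpan S')) ?_)).2 key
  dsimp [-colim_map]
  rw [← Functor.map_comp, ← Functor.map_comp]
  simp [σ]

end Colimit

/-! ### Tensor products and pushout-products of cofibrant data -/

section Monoidal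

variable {M : Type u} [Category.{v} M] [ModelCategory M] [MonoidalCategory M]
  [IsMonoidalModelCategory M]

instance preservesColimits_tensorLeft (X : M) : PreservesColimits (tensorLeft X) :=
  have := IsMonoidalModelCategory.closed_left X
  inferInstance

instance preservesColimits_tensorRight (X : M) : PreservesColimits (tensorRight X) :=
  have := IsMonoidalModelCategory.closed_right X
  inferInstance

/-- The pushout-product with `⊥_ M ⟶ X` on the left is the left whiskering by `X`. -/
lemma nonempty_iso_whiskerLeft (X : M) {U V : M} (f : U ⟶ V) :
    Nonempty (Arrow.mk (pushoutProductHom (initial.to X) f) ≅ Arrow.mk (X ◁ f)) := by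
  -- Tensoring preserves the initial object, so the pushout in the source of the pushout-product
  -- collapses to `X ⊗ U`.
  have h (Y : M) : PreservesColimitsOfShape (Discrete PEmpty.{1})
      ((curriedTensor M).flip.obj Y) :=
    inferInstanceAs (PreservesColimitsOfShape _ (tensorRight Y))
  have := h U
  have := h V
  exact ⟨Functor.PushoutObjObj.ι_iso_of_iso_left (F := curriedTensor M)
    (f₁ := Arrow.mk (initial.to X)) (f₁' := Arrow.mk (initial.to X)) (f₂ := Arrow.mk f)
    (Functor.PushoutObjObj.ofHasPushout _ _ _)
    (Functor.PushoutObjObj.ofIsInitialLeft _ _ _ initialIsInitial) (Iso.refl _)⟩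

/-- The pushout-product with `⊥_ M ⟶ X` on the right is the right whiskering by `X`. -/
lemma nonempty_iso_whiskerRight {U V : M} (f : U ⟶ V) (X : M) :
    Nonempty (Arrow.mk (pushoutProductHom f (initial.to X)) ≅ Arrow.mk (f ▷ X)) := by
  have h (Y : M) : PreservesColimitsOfShape (Discrete PEmpty.{1}) ((curriedTensor M).obj Y) :=
    inferInstanceAs (PreservesColimitsOfShape _ (tensorLeft Y))
  have := h U
  have := h V
  exact ⟨Functor.PushoutObjObj.ι_iso_of_iso_left (F := curriedTensor M)
    (f₁ := Arrow.mk f) (f₁' := Arrow.mk f) (f₂ := Arrow.mk (initial.to X))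
    (Functor.PushoutObjObj.ofHasPushout _ _ _)
    (Functor.PushoutObjObj.ofIsInitialRight _ _ _ initialIsInitial) (Iso.refl _)⟩

instance cofibration_whiskerLeft (X : M) [IsCofibrant X] {U V : M} (f : U ⟶ V) [Cofibration f] :
    Cofibration (X ◁ f) := by
  obtain ⟨e⟩ := nonempty_iso_whiskerLeft X f
  have := IsMonoidalModelCategory.cofibration_pushoutProduct (initial.to X) f
  rw [cofibration_iff] at this ⊢
  exact ((cofibrations M).arrow_mk_iso_iff e).1 this

instance cofibration_whiskerRight {U V : M} (f : U ⟶ V) [Cofibration f] (X : M) [IsCofibrant X] :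
    Cofibration (f ▷ X) := by
  obtain ⟨e⟩ := nonempty_iso_whiskerRight f X
  have := IsMonoidalModelCategory.cofibration_pushoutProduct f (initial.to X)
  rw [cofibration_iff] at this ⊢
  exact ((cofibrations M).arrow_mk_iso_iff e).1 this

instance isCofibrant_tensorObj (X Y : M) [IsCofibrant X] [IsCofibrant Y] :
    IsCofibrant (X ⊗ Y) :=
  (isCofibrant_iff_of_isInitial (X ◁ initial.to Y)
    (IsInitial.isInitialObj (tensorLeft X) _ initialIsInitial)).2 inferInstance

/-- Ken Brown's lemma reduces to trivial cofibrations, where the pushout-product axiom with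
`initial.to X` applies. -/
lemma weakEquivalence_whiskerLeft (X : M) [IsCofibrant X] {U V : M} (f : U ⟶ V)
    [IsCofibrant U] [IsCofibrant V] [WeakEquivalence f] : WeakEquivalence (X ◁ f) := by
  refine weakEquivalence_map_of_isCofibrant (tensorLeft X) (fun U V f _ _ _ _ => ?_) f
  obtain ⟨e⟩ := nonempty_iso_whiskerLeft X f
  have := IsMonoidalModelCategory.weakEquivalence_pushoutProduct_right (initial.to X) f
  rw [weakEquivalence_iff] at this ⊢
  exact ((weakEquivalences M).arrow_mk_iso_iff e).1 this

lemma weakEquivalence_whiskerRight {U V : M} (f : U ⟶ V) (X : M) [IsCofibrant X]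
    [IsCofibrant U] [IsCofibrant V] [WeakEquivalence f] : WeakEquivalence (f ▷ X) := by
  refine weakEquivalence_map_of_isCofibrant (tensorRight X) (fun U V f _ _ _ _ => ?_) f
  obtain ⟨e⟩ := nonempty_iso_whiskerRight f X
  have := IsMonoidalModelCategory.weakEquivalence_pushoutProduct_left f (initial.to X)
  rw [weakEquivalence_iff] at this ⊢
  exact ((weakEquivalences M).arrow_mk_iso_iff e).1 this

/-- The pushout-product of cofibrations between cofibrant objects has cofibrant source. -/
lemma isCofibrant_pushoutProduct_left (f g : Arrow M) [IsCofibrant f.left] [Cofibration f.hom]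
    [IsCofibrant g.left] [Cofibration g.hom] :
    IsCofibrant ((pushoutProduct M).obj (f, g)).left := by
  have : IsCofibrant g.right := isCofibrant_of_cofibration g.hom
  have h : IsCofibrant (pushout (f.hom ▷ g.left) (f.left ◁ g.hom)) :=
    isCofibrant_of_cofibration (pushout.inr (f.hom ▷ g.left) (f.left ◁ g.hom))
  exact h

/-- On targets the map is a whiskering. On sources it is a map of pushouts, and the gluing lemma
applies because tensoring `g.hom` with a cofibrant object gives a cofibration. -/
lemma arrowW_pushoutProduct_map_left {f f' : Arrow M} (τ : f ⟶ f') (g : Arrow M)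
    [IsCofibrant f.left] [Cofibration f.hom] [IsCofibrant f'.left] [Cofibration f'.hom]
    [IsCofibrant g.left] [Cofibration g.hom] (hτ : arrowW M τ) :
    arrowW M ((MonoidalCategory.Arrow.pushoutProduct.map τ).app g) := by
  have : IsCofibrant f.right := isCofibrant_of_cofibration f.hom
  have : IsCofibrant f'.right := isCofibrant_of_cofibration f'.hom
  have : IsCofibrant g.right := isCofibrant_of_cofibration g.hom
  have : WeakEquivalence τ.left := (weakEquivalence_iff _).2 hτ.1
  have : WeakEquivalence τ.right := (weakEquivalence_iff _).2 hτ.2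
  have := weakEquivalence_whiskerRight τ.left g.left
  have := weakEquivalence_whiskerRight τ.left g.right
  have := weakEquivalence_whiskerRight τ.right g.left
  have := weakEquivalence_whiskerRight τ.right g.right
  refine ⟨?_, this.mem⟩
  let k : pushout (f.hom ▷ g.left) (f.left ◁ g.hom) ⟶
      pushout (f'.hom ▷ g.left) (f'.left ◁ g.hom) := ((MonoidalCategory.Arrow.pushoutProduct.map τ).app g).left
  have hk : k = pushout.map _ _ _ _ (τ.right ▷ g.left) (τ.left ▷ g.right) (τ.left ▷ g.left)
      (by simp only [← comp_whiskerRight, Arrow.w]) (whisker_exchange _ _) := by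
    refine pushout.hom_ext ?_ ?_
    · rw [pushout.inl_desc]
      exact IsPushout.inl_desc _ _ _ _
    · rw [pushout.inr_desc]
      exact IsPushout.inr_desc _ _ _ _
  change weakEquivalences M k
  rw [hk]
  exact (weakEquivalence_pushoutMap _ _ _ _ _ _ _ _ _).mem

lemma arrowW_pushoutProduct_map_right (f : Arrow M) {g g' : Arrow M} (τ : g ⟶ g')
    [IsCofibrant f.left] [Cofibration f.hom] [IsCofibrant g.left] [Cofibration g.hom]
    [IsCofibrant g'.left] [Cofibration g'.hom] (hτ : arrowW M τ) :
    arrowW M ((MonoidalCategory.Arrow.pushoutProduct.obj f).map τ) := by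
  have : IsCofibrant f.right := isCofibrant_of_cofibration f.hom
  have : IsCofibrant g.right := isCofibrant_of_cofibration g.hom
  have : IsCofibrant g'.right := isCofibrant_of_cofibration g'.hom
  have : WeakEquivalence τ.left := (weakEquivalence_iff _).2 hτ.1
  have : WeakEquivalence τ.right := (weakEquivalence_iff _).2 hτ.2
  have := weakEquivalence_whiskerLeft f.left τ.left
  have := weakEquivalence_whiskerLeft f.left τ.right
  have := weakEquivalence_whiskerLeft f.right τ.left
  have := weakEquivalence_whiskerLeft f.right τ.right
  refine ⟨?_, this.mem⟩
  let k : pushout (f.hom ▷ g.left) (f.left ◁ g.hom) ⟶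
      pushout (f.hom ▷ g'.left) (f.left ◁ g'.hom) := ((MonoidalCategory.Arrow.pushoutProduct.obj f).map τ).left
  have hk : k = pushout.map _ _ _ _ (f.right ◁ τ.left) (f.left ◁ τ.right) (f.left ◁ τ.left)
      (whisker_exchange _ _).symm (by simp only [← whiskerLeft_comp, Arrow.w]) := by
    refine pushout.hom_ext ?_ ?_
    · rw [pushout.inl_desc]
      exact IsPushout.inl_desc _ _ _ _
    · rw [pushout.inr_desc]
      exact IsPushout.inr_desc _ _ _ _
  change weakEquivalences M k
  rw [hk]
  exact (weakEquivalence_pushoutMap _ _ _ _ _ _ _ _ _).mem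

end Monoidal

/-! ### Functors adapted to the replacements -/

section Adapted

variable {M : Type u} [Category.{v} M] [ModelCategory M]
  (φ : (cofibrations M).FunctorialFactorizationData (trivialFibrations M))

lemma adapted_colim :
    (spanReplacement φ).Adapted ((colim : (WalkingSpan ⥤ M) ⥤ M) ⋙ Ho.Q M) := by
  rintro S S' τ ⟨_, _, _⟩ ⟨_, _, _⟩ hτ
  exact Localization.inverts (Ho.Q M) (weakEquivalences M) _ (weakEquivalence_colim_map τ hτ)

variable [MonoidalCategory M] [IsMonoidalModelCategory M]

lemma adapted_tensor :
    ((cofibrantReplacement φ).prod (cofibrantReplacement φ)).Adapted (tensor M ⋙ Ho.Q M) := by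
  rintro ⟨X, U⟩ ⟨Y, V⟩ ⟨f, g⟩ ⟨hX, hU⟩ ⟨hY, hV⟩ ⟨hf, hg⟩
  have : IsCofibrant X := hX
  have : IsCofibrant U := hU
  have : IsCofibrant Y := hY
  have : IsCofibrant V := hV
  have : WeakEquivalence f := (weakEquivalence_iff _).2 hf
  have : WeakEquivalence g := (weakEquivalence_iff _).2 hg
  have := weakEquivalence_whiskerRight f U
  have := weakEquivalence_whiskerLeft Y g
  refine Localization.inverts (Ho.Q M) (weakEquivalences M) (f ⊗ₘ g) ?_
  rw [MonoidalCategory.tensorHom_def]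
  have : WeakEquivalence (f ▷ U ≫ Y ◁ g) := inferInstance
  exact this.mem

/-- The variables are changed one at a time, through the pair `(f', g)`, which is again good. -/
lemma adapted_pushoutProduct :
    ((arrowReplacement φ).prod (arrowReplacement φ)).Adapted
      (pushoutProduct M ⋙ (arrowW M).Q) := by
  rintro ⟨f, g⟩ ⟨f', g'⟩ ⟨τ, σ⟩ ⟨⟨_, _⟩, ⟨_, _⟩⟩ ⟨⟨_, _⟩, ⟨_, _⟩⟩ ⟨hτ, hσ⟩
  have h₁ := arrowW_pushoutProduct_map_left τ g hτ
  have h₂ := arrowW_pushoutProduct_map_right f' σ hσ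
  exact Localization.inverts (arrowW M).Q (arrowW M) _
    ⟨(weakEquivalences M).comp_mem _ _ h₁.1 h₂.1, (weakEquivalences M).comp_mem _ _ h₁.2 h₂.2⟩

/-- This closure property allows `cone` to be computed after the pushout-product without a second
replacement. -/
lemma good_pushoutProduct (f g : Arrow M) (hf : (arrowReplacement φ).good f)
    (hg : (arrowReplacement φ).good g) :
    (arrowReplacement φ).good ((pushoutProduct M).obj (f, g)) := by
  obtain ⟨_, _⟩ := hf
  obtain ⟨_, _⟩ := hg
  exact ⟨isCofibrant_pushoutProduct_left f g,
    IsMonoidalModelCategory.cofibration_pushoutProduct f.hom g.hom⟩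

end Adapted

/-! ### Cokernels as a property of pairs of morphisms -/

section IsCoker

variable {C : Type u} [Category.{v} C] [HasZeroMorphisms C]

/-- The morphism `p` is a cokernel of `f`. -/
structure IsCoker {X Y Z : C} (f : X ⟶ Y) (p : Y ⟶ Z) : Prop where
  zero : f ≫ p = 0
  epi : Epi p
  exists_desc {T : C} (t : Y ⟶ T) (ht : f ≫ t = 0) : ∃ u : Z ⟶ T, p ≫ u = t

lemma IsCoker.of_isPushout {X Y Z O : C} {a : X ⟶ O} {f : X ⟶ Y} {b : O ⟶ Z} {p : Y ⟶ Z}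
    (hO : IsZero O) (h : IsPushout a f b p) : IsCoker f p where
  zero := by rw [← h.w, hO.eq_zero_of_src b, comp_zero]
  epi := ⟨fun _ _ hu => h.hom_ext (hO.eq_of_src _ _) hu⟩
  exists_desc t ht := ⟨h.desc 0 t (by rw [ht, comp_zero]), h.inr_desc _ _ _⟩

lemma IsCoker.isIso {X Y Z Z' : C} {f : X ⟶ Y} {p : Y ⟶ Z} {p' : Y ⟶ Z'} (h : IsCoker f p)
    (h' : IsCoker f p') (c : Z ⟶ Z') (hc : p ≫ c = p') : IsIso c := by
  obtain ⟨u, hu⟩ := h'.exists_desc p h.zero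
  have := h.epi
  have := h'.epi
  refine ⟨u, ?_, ?_⟩
  · rw [← cancel_epi p, reassoc_of% hc, hu, Category.comp_id]
  · rw [← cancel_epi p', reassoc_of% hu, hc, Category.comp_id]

end IsCoker

/-- A functor that preserves colimits preserves zero objects. -/
lemma isZero_obj_zero {C : Type u} [Category.{v} C] [HasZeroObject C] (F : C ⥤ C)
    [PreservesColimits F] : IsZero (F.obj (HasZeroObject.zero' C).zero) :=
  (isZero_zero C).of_iso ((IsInitial.isInitialObj F _ (isZero_zero C).isInitial).uniqueUpToIso
    (isZero_zero C).isInitial)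

/-! ### The strict cofiber and its compatibility with pushout-products -/

section Cofiber

variable {M : Type u} [Category.{v} M] [ModelCategory M] [HasZeroObject M]

open scoped ZeroObject

/-- The strict cofiber functor: the colimit of the cokernel diagram. -/
noncomputable def cofiber (M : Type u) [Category.{v} M] [ModelCategory M] [HasZeroObject M] :
    Arrow M ⥤ M :=
  cokernelDiagram M ⋙ colim

/-- The projection from the target of an arrow to its cofiber. -/
noncomputable def cofiberπ (f : Arrow M) : f.right ⟶ (cofiber M).obj f :=
  colimit.ι ((cokernelDiagram M).obj f) WalkingSpan.right

lemma cofiberπ_naturality {f g : Arrow M} (τ : f ⟶ g) :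
    cofiberπ f ≫ (cofiber M).map τ = τ.right ≫ cofiberπ g :=
  ι_colimMap ((cokernelDiagram M).map τ) WalkingSpan.right

lemma isPushout_cofiberπ (f : Arrow M) :
    IsPushout ((isZero_zero M).from_ f.left) f.hom
      (colimit.ι ((cokernelDiagram M).obj f) WalkingSpan.left) (cofiberπ f) :=
  IsPushout.of_hasPushout ((isZero_zero M).from_ f.left) f.hom

lemma isCofibrant_zero : IsCofibrant (0 : M) := by
  have : IsIso (initial.to (0 : M)) := isIso_of_isInitial initialIsInitial
    (isZero_zero M).isInitial _
  infer_instance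

/-- The map from `0` to the cofiber is a cobase change of `f.hom`. -/
lemma isCofibrant_cofiber (f : Arrow M) [Cofibration f.hom] :
    IsCofibrant ((cofiber M).obj f) := by
  have := isCofibrant_zero (M := M)
  have h : IsCofibrant (pushout ((isZero_zero M).from_ f.left) f.hom) :=
    isCofibrant_of_cofibration (pushout.inl ((isZero_zero M).from_ f.left) f.hom)
  exact h

section ZeroMorphisms

variable [HasZeroMorphisms M]

lemma isCoker_cofiberπ (f : Arrow M) : IsCoker f.hom (cofiberπ f) :=
  .of_isPushout (isZero_zero M) (isPushout_cofiberπ f)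

variable [MonoidalCategory M] [IsMonoidalModelCategory M]

lemma isCoker_whiskerRight (f : Arrow M) (W : M) :
    IsCoker (f.hom ▷ W) (cofiberπ f ▷ W) :=
  .of_isPushout (isZero_obj_zero (tensorRight W))
    ((isPushout_cofiberπ f).map (tensorRight W))

lemma isCoker_whiskerLeft (W : M) (f : Arrow M) :
    IsCoker (W ◁ f.hom) (W ◁ cofiberπ f) :=
  .of_isPushout (isZero_obj_zero (tensorLeft W))
    ((isPushout_cofiberπ f).map (tensorLeft W))

/-- The tensor product of two cofibers is a cofiber of the pushout-product. -/
lemma isCoker_pushoutProduct (f g : Arrow M) :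
    IsCoker ((pushoutProduct M).obj (f, g)).hom (cofiberπ f ⊗ₘ cofiberπ g) := by
  let p : pushout (f.hom ▷ g.left) (f.left ◁ g.hom) ⟶ f.right ⊗ g.right :=
    ((pushoutProduct M).obj (f, g)).hom
  have hl : pushout.inl (f.hom ▷ g.left) (f.left ◁ g.hom) ≫ p = f.right ◁ g.hom :=
    pushout.inl_desc _ _ _
  have hr : pushout.inr (f.hom ▷ g.left) (f.left ◁ g.hom) ≫ p = f.hom ▷ g.right :=
    pushout.inr_desc _ _ _
  have h₁ := isCoker_whiskerRight f g.right
  have h₂ := isCoker_whiskerLeft ((cofiber M).obj f) g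
  have := h₁.epi
  have := h₂.epi
  have := (isCoker_whiskerRight f g.left).epi
  suffices IsCoker p (cofiberπ f ▷ g.right ≫ (cofiber M).obj f ◁ cofiberπ g) by
    rw [← MonoidalCategory.tensorHom_def] at this
    exact this
  refine ⟨?_, epi_comp _ _, fun {T} t ht => ?_⟩
  · ext
    · rw [comp_zero, reassoc_of% hl, whisker_exchange_assoc, h₂.zero, comp_zero]
    · rw [comp_zero, reassoc_of% hr, reassoc_of% h₁.zero, zero_comp]
  · have t₁ : f.right ◁ g.hom ≫ t = 0 := by rw [← hl, Category.assoc, ht, comp_zero]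
    have t₂ : f.hom ▷ g.right ≫ t = 0 := by rw [← hr, Category.assoc, ht, comp_zero]
    -- The cokernels are taken one variable at a time. That `t'` kills the second arrow is tested
    -- after the epimorphism `cofiberπ f ▷ g.left`, where the interchange law reduces it to `t₁`.
    obtain ⟨t', rfl⟩ := h₁.exists_desc t t₂
    obtain ⟨t'', rfl⟩ := h₂.exists_desc t' (by
      rw [← cancel_epi (cofiberπ f ▷ g.left), comp_zero, ← whisker_exchange_assoc, t₁])
    exact ⟨t'', Category.assoc _ _ _⟩

lemma exists_cofiberComparison (f g : Arrow M) :
    ∃ c : (cofiber M).obj ((pushoutProduct M).obj (f, g)) ⟶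
      (cofiber M).obj f ⊗ (cofiber M).obj g,
      cofiberπ ((pushoutProduct M).obj (f, g)) ≫ c = cofiberπ f ⊗ₘ cofiberπ g :=
  (isCoker_cofiberπ _).exists_desc _ (isCoker_pushoutProduct f g).zero

end ZeroMorphisms

variable [MonoidalCategory M] [IsMonoidalModelCategory M]

/-- The strict cofiber functor is monoidal with respect to the pushout-product. -/
lemma nonempty_cofiberTensorIso :
    Nonempty ((cofiber M).prod (cofiber M) ⋙ tensor M ≅ pushoutProduct M ⋙ cofiber M) := by
  let _ : HasZeroMorphisms M := HasZeroObject.zeroMorphismsOfZeroObject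
  -- The pointwise choice is harmless: `cofiberπ` is epi, so `hc` determines `c`, and naturality can
  -- be tested on targets.
  choose c hc using exists_cofiberComparison (M := M)
  have (f g : Arrow M) : IsIso (c f g) :=
    (isCoker_cofiberπ _).isIso (isCoker_pushoutProduct f g) _ (hc f g)
  refine ⟨(NatIso.ofComponents (fun p => asIso (c p.1 p.2)) ?_).symm⟩
  rintro ⟨f, g⟩ ⟨f', g'⟩ ⟨τ, σ⟩
  have := (isCoker_cofiberπ ((pushoutProduct M).obj (f, g))).epi
  have h : (τ.right ⊗ₘ σ.right) ≫ (cofiberπ f' ⊗ₘ cofiberπ g') =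
      (cofiberπ f ⊗ₘ cofiberπ g) ≫ ((cofiber M).map τ ⊗ₘ (cofiber M).map σ) := by
    dsimp only at τ σ
    rw [MonoidalCategory.tensorHom_comp_tensorHom, MonoidalCategory.tensorHom_comp_tensorHom,
      cofiberπ_naturality, cofiberπ_naturality]
  have hr : ((pushoutProduct M).map ((τ, σ) : (f, g) ⟶ (f', g'))).right = τ.right ⊗ₘ σ.right :=
    (MonoidalCategory.tensorHom_def _ _).symm
  refine (cancel_epi (cofiberπ ((pushoutProduct M).obj (f, g)))).1 ?_
  change _ ≫ (cofiber M).map ((pushoutProduct M).map (τ, σ)) ≫ c f' g' =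
    _ ≫ c f g ≫ ((cofiber M).map τ ⊗ₘ (cofiber M).map σ)
  rw [← Category.assoc, cofiberπ_naturality, Category.assoc, hc, ← Category.assoc, hc, hr]
  exact h

end Cofiber

/-! ### Comparing functors on a localization through replacements -/

section Comparison

universe v₁ v₂ v₃ u₁ u₂ u₃

variable {C : Type u₁} {D : Type u₂} {H : Type u₃} [Category.{v₁} C] [Category.{v₂} D]
  [Category.{v₃} H] {W : MorphismProperty C}

/-- A natural transformation out of `L ⋙ G` that is an isomorphism at good objects computes `G`
by replacement. -/
lemma LeftDeformation.nonempty_iso_of_isIso_app (d : LeftDeformation W) {L : C ⥤ D}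
    [L.IsLocalization W] {G : D ⥤ H} {N : C ⥤ H} (α : L ⋙ G ⟶ N)
    (hα : ∀ X, d.good X → IsIso (α.app X)) : Nonempty (L ⋙ G ≅ d.R ⋙ N) := by
  have h₁ (X : C) : IsIso ((Functor.whiskerRight d.ρ (L ⋙ G)).app X) := by
    have := Localization.inverts L W _ (d.weq X)
    exact inferInstanceAs (IsIso (G.map (L.map (d.ρ.app X))))
  have h₂ (X : C) : IsIso ((Functor.whiskerLeft d.R α).app X) := hα _ (d.good_obj X)
  have := NatIso.isIso_of_isIso_app (Functor.whiskerRight d.ρ (L ⋙ G))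
  have := NatIso.isIso_of_isIso_app (Functor.whiskerLeft d.R α)
  exact ⟨(Functor.leftUnitor _).symm ≪≫ (asIso (Functor.whiskerRight d.ρ (L ⋙ G))).symm ≪≫
    asIso (Functor.whiskerLeft d.R α)⟩

/-- Two functors on a localization are isomorphic if they are computed by isomorphic functors at
good objects. -/
lemma LeftDeformation.nonempty_iso (d : LeftDeformation W) (L : C ⥤ D) [L.IsLocalization W]
    {G₁ G₂ : D ⥤ H} {N₁ N₂ : C ⥤ H} (e : N₁ ≅ N₂) (α₁ : L ⋙ G₁ ⟶ N₁) (α₂ : L ⋙ G₂ ⟶ N₂)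
    (h₁ : ∀ X, d.good X → IsIso (α₁.app X)) (h₂ : ∀ X, d.good X → IsIso (α₂.app X)) :
    Nonempty (G₁ ≅ G₂) := by
  obtain ⟨e₁⟩ := d.nonempty_iso_of_isIso_app α₁ h₁
  obtain ⟨e₂⟩ := d.nonempty_iso_of_isIso_app α₂ h₂
  exact ⟨Localization.liftNatIso L W _ _ G₁ G₂ (e₁ ≪≫ Functor.isoWhiskerLeft d.R e ≪≫ e₂.symm)⟩

end Comparison

/-! ### The cone as a derived cofiber, and the final comparison -/

section Cone

variable {M : Type u} [Category.{v} M] [ModelCategory M] [HasZeroObject M]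

/-- The canonical map from the cone to the strict cofiber. -/
noncomputable def coneToCofiber (M : Type u) [Category.{v} M] [ModelCategory M] [HasZeroObject M]
    [HasHocolim WalkingSpan M] : (arrowW M).Q ⋙ cone M ⟶ cofiber M ⋙ Ho.Q M :=
  Functor.whiskerRight (Localization.fac (cokernelDiagram M ⋙ (diagramW WalkingSpan M).Q)
      (cokernelDiagram_inverts M) (arrowW M).Q).hom (hocolim WalkingSpan M) ≫
    Functor.whiskerLeft (cokernelDiagram M) (((colim : (WalkingSpan ⥤ M) ⥤ M) ⋙
      Ho.Q M).totalLeftDerivedCounit (diagramW WalkingSpan M).Q (diagramW WalkingSpan M))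

/-- The zero object is cofibrant, so the cokernel diagram of a good arrow is a good span, where the
counit of `hocolim` is invertible. -/
lemma isIso_coneToCofiber_app (φ : (cofibrations M).FunctorialFactorizationData
    (trivialFibrations M)) [HasHocolim WalkingSpan M] (f : Arrow M)
    (hf : (arrowReplacement φ).good f) : IsIso ((coneToCofiber M).app f) := by
  have : IsIso ((((colim : (WalkingSpan ⥤ M) ⥤ M) ⋙ Ho.Q M).totalLeftDerivedCounit
      (diagramW WalkingSpan M).Q (diagramW WalkingSpan M)).app ((cokernelDiagram M).obj f)) :=
    (adapted_colim φ).isIso_counit_app _ _ _ ⟨isCofibrant_zero, hf.1, hf.2⟩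
  exact IsIso.comp_isIso' (inferInstanceAs (IsIso ((hocolim WalkingSpan M).map _))) this

variable [MonoidalCategory M] [IsMonoidalModelCategory M]

/-- Each side maps to its strict counterpart, by `α₁` and `α₂`. At good pairs `α₁` is invertible
because cofibers are cofibrant, and `α₂` because pushout-products of good arrows are good. -/
theorem nonempty_coneTensorIso (φ : (cofibrations M).FunctorialFactorizationData
    (trivialFibrations M)) [HasHocolim WalkingSpan M] [HasDerivedTensor M]
    [HasDerivedPushoutProduct M] :
    Nonempty ((cone M).prod (cone M) ⋙ derivedTensor M ≅
      derivedPushoutProduct M ⋙ cone M) := by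
  obtain ⟨e⟩ := nonempty_cofiberTensorIso (M := M)
  let α := (tensor M ⋙ Ho.Q M).totalLeftDerivedCounit ((Ho.Q M).prod (Ho.Q M))
    ((weakEquivalences M).prod (weakEquivalences M))
  let β := (pushoutProduct M ⋙ (arrowW M).Q).totalLeftDerivedCounit
    ((arrowW M).Q.prod (arrowW M).Q) ((arrowW M).prod (arrowW M))
  let θ := coneToCofiber M
  let α₁ : ((arrowW M).Q.prod (arrowW M).Q) ⋙ (cone M).prod (cone M) ⋙ derivedTensor M ⟶
      ((cofiber M).prod (cofiber M) ⋙ tensor M) ⋙ Ho.Q M :=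
    Functor.whiskerRight (NatTrans.prod θ θ) (derivedTensor M) ≫
      Functor.whiskerLeft ((cofiber M).prod (cofiber M)) α
  let α₂ : ((arrowW M).Q.prod (arrowW M).Q) ⋙ derivedPushoutProduct M ⋙ cone M ⟶
      (pushoutProduct M ⋙ cofiber M) ⋙ Ho.Q M :=
    Functor.whiskerRight β (cone M) ≫ Functor.whiskerLeft (pushoutProduct M) θ
  refine ((arrowReplacement φ).prod (arrowReplacement φ)).nonempty_iso
    ((arrowW M).Q.prod (arrowW M).Q) (Functor.isoWhiskerRight e (Ho.Q M)) α₁ α₂ ?_ ?_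
  · rintro ⟨f, g⟩ ⟨hf, hg⟩
    have h₁ : IsIso (θ.app f) := isIso_coneToCofiber_app φ f hf
    have h₂ : IsIso (θ.app g) := isIso_coneToCofiber_app φ g hg
    have h₃ : IsIso ((NatTrans.prod θ θ).app (f, g)) := (isIso_prod_iff _ _).2 ⟨h₁, h₂⟩
    have h₄ : IsIso (α.app ((cofiber M).obj f, (cofiber M).obj g)) := by
      have := hf.2
      have := hg.2
      exact (adapted_tensor φ).isIso_counit_app _ _ _
        ⟨isCofibrant_cofiber f, isCofibrant_cofiber g⟩
    exact IsIso.comp_isIso' (inferInstanceAs (IsIso ((derivedTensor M).map _))) h₄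
  · rintro ⟨f, g⟩ hfg
    have h₁ : IsIso (β.app (f, g)) := (adapted_pushoutProduct φ).isIso_counit_app _ _ _ hfg
    have h₂ : IsIso (θ.app ((pushoutProduct M).obj (f, g))) :=
      isIso_coneToCofiber_app φ _ (good_pushoutProduct φ f g hfg.1 hfg.2)
    exact IsIso.comp_isIso' (inferInstanceAs (IsIso ((cone M).map (β.app (f, g))))) h₂

end Cone

end StableCone

/-- In a stable monoidal model category `M`, the homotopy pushout functor (hence the cone), the
derived smash product and the derived pushout-product exist, and there is an isomorphism
`cone(f) ∧ᴸ cone(g) ≅ cone(f □ᴸ g)`, natural in `f` and `g` in `Ho(M^{0 < 1})`. -/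
theorem mainTheorem4 (M : Type u) [Category.{v} M] [ModelCategory M] [HasZeroObject M]
    [MonoidalCategory M] [StableCone.IsMonoidalModelCategory M] [StableCone.IsStable M] :
    ∃ (_ : StableCone.HasHocolim WalkingSpan M) (_ : StableCone.HasDerivedTensor M)
      (_ : StableCone.HasDerivedPushoutProduct M),
      Nonempty ((StableCone.cone M).prod (StableCone.cone M) ⋙ StableCone.derivedTensor M ≅
        StableCone.derivedPushoutProduct M ⋙ StableCone.cone M) := by
  obtain ⟨⟨φ⟩⟩ := StableCone.IsMonoidalModelCategory.functorial_factorization₂ (M := M)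
  have h₁ : StableCone.HasHocolim WalkingSpan M :=
    (StableCone.adapted_colim φ).hasLeftDerivedFunctor
  have h₂ : StableCone.HasDerivedTensor M := (StableCone.adapted_tensor φ).hasLeftDerivedFunctor
  have h₃ : StableCone.HasDerivedPushoutProduct M :=
    (StableCone.adapted_pushoutProduct φ).hasLeftDerivedFunctor
  exact ⟨h₁, h₂, h₃, StableCone.nonempty_coneTensorIso φ⟩
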